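/- Let $f:\mathbb{R}^n\to\mathbb{R}$ be twice continuously differentiable and let $g:\mathbb{R}^n\to\mathbb{R}\cup\{+\infty\}$ be a proper polyhedral function (its epigraph is the intersection of finitely many closed half-spaces of $\mathbb{R}^n\times\mathbb{R}$) with $\mathrm{dom}\,g=\{x: g(x)<\infty\}\subseteq\mathbb{R}^n_+$. Put $\phi(x)=f(x)+g(x)$ and $\Phi(y)=f(y^2)+g(y^2)$, where $y^2$ is the componentwise square. For an extended real-valued function $h$ on $\mathbb{R}^n$ and a point $x$ with $h(x)$ finite, $\hat\partial h(x)$ denotes the set of $v$ with $h(z)\ge h(x)+\langle v,z-x\rangle+o(\|z-x\|)$ as $z\to x$, and the subdifferential $\partial h(x)$ is the set of limits $v=\lim v^k$ with $v^k\in\hat\partial h(x^k)$, $x^k\to x$, $h(x^k)\to h(x)$; if $h(x)$ is not finite, $\partial h(x)=\emptyset$. A proper lower semicontinuous $h$ has the Kurdyka–Łojasiewicz (KL) property at $\bar x$ with exponent $\alpha\in[0,1)$ if $\partial h(\bar x)\neq\emptyset$ and there are $\bar c>0$, $a\in(0,\infty]$ and a neighborhood $V$ of $\bar x$ such that, with $\varphi(s)=\bar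 c\,s^{1-\alpha}$, $$\varphi'\big(h(x)-h(\bar x)\big)\,\mathrm{dist}\big(0,\partial h(x)\big)\ge 1\qquad\text{for all }x\in V\text{ with }0<h(x)-h(\bar x)<a,$$ where $\mathrm{dist}(0,\emptyset)=+\infty$. Let $\bar y\in\mathbb{R}^n$ and $\bar x=\bar y^2$. Suppose that strict complementarity $0\in\mathrm{ri}\,(\partial\phi(\bar x))$ holds, where $\mathrm{ri}$ denotes the relative interior, and that $\phi$ has the KL property at $\bar x$ with exponent $\alpha\in(0,1)$. Then $\Phi$ has the KL property at $\bar y$ with exponent $\max\{\alpha,1/2\}$. -/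

import Mathlib

open Filter Topology
open scoped ENNReal

/-- Componentwise square `y ↦ y²` on `ℝⁿ`. -/
noncomputable def sqMap {n : ℕ} (y : EuclideanSpace ℝ (Fin n)) : EuclideanSpace ℝ (Fin n) :=
  WithLp.toLp 2 (fun i => y i ^ 2)

/-- An extended real-valued function is proper if it never takes the value `-∞`
and is not identically `+∞`. -/
def ProperFun {X : Type*} (h : X → EReal) : Prop :=
  (∀ x, h x ≠ ⊥) ∧ ∃ x, h x ≠ ⊤

/-- A polyhedral set: the intersection of finitely many closed half-spaces
(the whole space if there are none). -/
def IsPolyhedralSet {V : Type*} [AddCommGroup V] [Module ℝ V] (S : Set V) : Prop :=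
  ∃ (m : ℕ) (a : Fin m → (V →ₗ[ℝ] ℝ)) (b : Fin m → ℝ), S = {x | ∀ i, a i x ≤ b i}

/-- A polyhedral function: its epigraph is a polyhedral set. -/
def IsPolyhedralFun {V : Type*} [AddCommGroup V] [Module ℝ V] (g : V → EReal) : Prop :=
  IsPolyhedralSet {p : V × ℝ | g p.1 ≤ (p.2 : EReal)}

/-- `v` is a regular (Fréchet) subgradient of `h` at `x`: `h x` is finite and
`h z ≥ h x + ⟨v, z - x⟩ + o(‖z - x‖)` as `z → x`. -/
def IsRegularSubgradient {n : ℕ} (h : EuclideanSpace ℝ (Fin n) → EReal)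
    (x v : EuclideanSpace ℝ (Fin n)) : Prop :=
  h x ≠ ⊥ ∧ h x ≠ ⊤ ∧ ∀ ε : ℝ, 0 < ε → ∀ᶠ z in 𝓝 x,
    h x + ((inner ℝ v (z - x) - ε * ‖z - x‖ : ℝ) : EReal) ≤ h z

/-- The (limiting) subdifferential `∂h(x)`: all limits of regular subgradients `vₖ` at points
`xₖ → x` with `h(xₖ) → h(x)`. It is empty where `h` is not finite. -/
def subdiff {n : ℕ} (h : EuclideanSpace ℝ (Fin n) → EReal)
    (x : EuclideanSpace ℝ (Fin n)) : Set (EuclideanSpace ℝ (Fin n)) :=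
  {v | h x ≠ ⊥ ∧ h x ≠ ⊤ ∧ ∃ xs vs : ℕ → EuclideanSpace ℝ (Fin n),
    (∀ k, IsRegularSubgradient h (xs k) (vs k)) ∧
    Tendsto xs atTop (𝓝 x) ∧ Tendsto (fun k => h (xs k)) atTop (𝓝 (h x)) ∧
    Tendsto vs atTop (𝓝 v)}

/-- `ψ` is a desingularizing function on `[0, a)`, where `a ∈ (0, ∞]`. -/
def IsDesingularizing (a : EReal) (ψ : ℝ → ℝ) : Prop :=
  ψ 0 = 0 ∧
  (∀ s : ℝ, 0 ≤ s → (s : EReal) < a → 0 ≤ ψ s) ∧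
  ContinuousOn ψ {s : ℝ | 0 ≤ s ∧ (s : EReal) < a} ∧
  ConcaveOn ℝ {s : ℝ | 0 ≤ s ∧ (s : EReal) < a} ψ ∧
  DifferentiableOn ℝ ψ {s : ℝ | 0 < s ∧ (s : EReal) < a} ∧
  ContinuousOn (deriv ψ) {s : ℝ | 0 < s ∧ (s : EReal) < a} ∧
  ∀ s : ℝ, 0 < s → (s : EReal) < a → 0 < deriv ψ s

/-- The proper closed function `h` has the Kurdyka–Łojasiewicz property at `x₀ ∈ dom ∂h` with
desingularizing function `ψ`. The distance is `+∞` to the empty set. -/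
def HasKLWith {n : ℕ} (h : EuclideanSpace ℝ (Fin n) → EReal)
    (x₀ : EuclideanSpace ℝ (Fin n)) (ψ : ℝ → ℝ) : Prop :=
  ProperFun h ∧ LowerSemicontinuous h ∧ (subdiff h x₀).Nonempty ∧
  ∃ a : EReal, 0 < a ∧ IsDesingularizing a ψ ∧ ∃ V ∈ 𝓝 x₀, ∀ x ∈ V,
    0 < h x - h x₀ → h x - h x₀ < a →
      1 ≤ ENNReal.ofReal (deriv ψ (h x - h x₀).toReal) * Metric.infEDist 0 (subdiff h x)

/-- `h` has the Kurdyka–Łojasiewicz property at `x₀` with exponent `α ∈ [0, 1)`. -/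
def HasKLExponent {n : ℕ} (h : EuclideanSpace ℝ (Fin n) → EReal)
    (x₀ : EuclideanSpace ℝ (Fin n)) (α : ℝ) : Prop :=
  0 ≤ α ∧ α < 1 ∧ ∃ c : ℝ, 0 < c ∧ HasKLWith h x₀ (fun s => c * s ^ (1 - α))

/-! Let `L` be the span of `∂φ(x₀)` and `q = -∇f(x₀)`. Strict complementarity puts an `ε`-ball of
`L` inside `∂φ(x₀)`, so `g` exceeds its linearization with slope `q` by `ε` times the length of the
`L`-component of `x - x₀`. Polyhedrality supplies the complement: near `x₀`, translations along `Lᗮ`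
change `g` only by `⟨q, ·⟩`. Since `dom g` lies in the nonnegative orthant, every coordinate
direction on which `y₀` vanishes belongs to `L`.

For `x = y²` near `x₀`, let `u` be the projection of `x - x₀` on `L` and `T x = x - u`. A regular
subgradient `v` of `Φ` at `y` is tested along curves whose square is `x + t d`. The choice `d = -u`
gives `√‖u‖ ≲ ‖v‖` by sharpness (`IsRegularSubgradient.sqrt_norm_le`); the square root comes from
the vanishing coordinates of `y₀`. The choice `d = -w`, with `w` the `Lᗮ`-part of `∇f(x) + q`, gives
`‖w‖ ≲ ‖v‖` (`IsRegularSubgradient.norm_le_of_affine`).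

The KL inequality of `φ` is used at `T x`, where the `Lᗮ`-part of `∇f(T x) + q` is a subgradient
within `O(‖u‖)` of `w`. As `φ(x) - φ(T x) = O(‖u‖)`, either this difference dominates, giving
exponent `1/2`, or `φ(T x) - φ(x₀)` does, giving exponent `α` (`rpow_max_half_le`). -/

/-! ### Subgradients of a smooth plus a polyhedral function -/

/-- `s` is a convex subgradient at `x` of a function with value `γ` at `x`, tested on
the epigraph. -/
def IsEpiSubgradient {n : ℕ} (g : EuclideanSpace ℝ (Fin n) → EReal)
    (x : EuclideanSpace ℝ (Fin n)) (γ : ℝ) (s : EuclideanSpace ℝ (Fin n)) : Prop :=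
  ∀ (z : EuclideanSpace ℝ (Fin n)) (τ : ℝ), g z ≤ τ → γ + inner ℝ s (z - x) ≤ τ

theorem IsPolyhedralFun.le_segment {n : ℕ} {g : EuclideanSpace ℝ (Fin n) → EReal}
    (hg : IsPolyhedralFun g) {x z : EuclideanSpace ℝ (Fin n)} {σ τ t : ℝ}
    (hx : g x ≤ σ) (hz : g z ≤ τ) (ht0 : 0 ≤ t) (ht1 : t ≤ 1) :
    g (x + t • (z - x)) ≤ ((σ + t * (τ - σ) : ℝ) : EReal) := by
  obtain ⟨m, a, b, h⟩ := hg
  have mem : ∀ (w : EuclideanSpace ℝ (Fin n)) (ω : ℝ), g w ≤ ω ↔ ∀ i, a i (w, ω) ≤ b i :=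
    fun w ω => Set.ext_iff.1 h (w, ω)
  rw [mem] at hx hz ⊢
  intro i
  have e : ((x + t • (z - x), σ + t * (τ - σ)) : EuclideanSpace ℝ (Fin n) × ℝ)
      = (1 - t) • (x, σ) + t • (z, τ) := by
    ext1
    · simp only [Prod.fst_add, Prod.smul_fst]; module
    · simp only [Prod.snd_add, Prod.smul_snd, smul_eq_mul]; ring
  rw [e, map_add, map_smul, map_smul, smul_eq_mul, smul_eq_mul]
  nlinarith [hx i, hz i, mul_le_mul_of_nonneg_left (hx i) (sub_nonneg.2 ht1),
    mul_le_mul_of_nonneg_left (hz i) ht0]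

theorem abs_taylor_gradient_le {n : ℕ} {f : EuclideanSpace ℝ (Fin n) → ℝ}
    {x : EuclideanSpace ℝ (Fin n)} (hf : DifferentiableAt ℝ f x) {ε : ℝ} (hε : 0 < ε) :
    ∀ᶠ z in 𝓝 x, |f z - f x - inner ℝ (gradient f x) (z - x)| ≤ ε * ‖z - x‖ := by
  have h := hf.hasGradientAt.hasFDerivAt.isLittleO.def hε
  filter_upwards [h] with z hz
  simpa using hz

theorem EReal.exists_real {e : EReal} (h1 : e ≠ ⊥) (h2 : e ≠ ⊤) : ∃ r : ℝ, e = r :=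
  ⟨e.toReal, (EReal.coe_toReal h2 h1).symm⟩

section Sum

variable {n : ℕ} {f : EuclideanSpace ℝ (Fin n) → ℝ} {g φ : EuclideanSpace ℝ (Fin n) → EReal}

/-- Convexity makes the local inequality global: it is applied at `x + t (z - x)`, divided by `t`,
and the two `o(t)` errors (subgradient and Taylor) cost `2 ε ‖z - x‖`. -/
theorem IsRegularSubgradient.exists_isEpiSubgradient (hf : Differentiable ℝ f)
    (hg : ∀ x, g x ≠ ⊥)
    (hgp : IsPolyhedralFun g) (hφ : ∀ x, φ x = (f x : EReal) + g x)
    {x v : EuclideanSpace ℝ (Fin n)} (hv : IsRegularSubgradient φ x v) :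
    ∃ γ : ℝ, g x = γ ∧ IsEpiSubgradient g x γ (v - gradient f x) := by
  obtain ⟨hb, ht, hv⟩ := hv
  have hgt : g x ≠ ⊤ := by
    intro h; rw [hφ, h] at ht; simp at ht
  obtain ⟨γ, hγ⟩ := EReal.exists_real (hg x) hgt
  refine ⟨γ, hγ, fun z τ hz => ?_⟩
  by_contra! hlt
  set d := z - x with hd
  have key : ∀ ε : ℝ, 0 < ε → inner ℝ (v - gradient f x) d - (2 * ε) * ‖d‖ ≤ τ - γ := by
    intro ε hε
    have h1 := (hv ε hε).and (abs_taylor_gradient_le (hf x) hε)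
    have hc : Tendsto (fun t : ℝ => x + t • d) (𝓝[>] 0) (𝓝 x) := by
      have : Continuous (fun t : ℝ => x + t • d) := by fun_prop
      simpa using (this.tendsto 0).mono_left nhdsWithin_le_nhds
    have h2 := (hc.eventually h1).and
      ((Ioo_mem_nhdsGT (zero_lt_one (α := ℝ))) : ∀ᶠ t in 𝓝[>] (0 : ℝ), t ∈ Set.Ioo (0 : ℝ) 1)
    obtain ⟨t, ⟨ha, hb⟩, ht0, ht1⟩ := h2.exists
    have hs := hgp.le_segment hγ.le hz ht0.le ht1.le
    rw [hφ, hφ, hγ] at ha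
    have ha' := ha.trans (add_le_add_right hs _)
    have ha2 : f x + γ + (inner ℝ v (x + t • d - x) - ε * ‖x + t • d - x‖)
        ≤ f (x + t • d) + (γ + t * (τ - γ)) := by exact_mod_cast ha'
    rw [add_sub_cancel_left, inner_smul_right, norm_smul, Real.norm_of_nonneg ht0.le] at ha2 hb
    have hb' := (abs_le.1 hb).2
    rw [inner_sub_left]
    have : t * (inner ℝ v d - inner ℝ (gradient f x) d - (2 * ε) * ‖d‖) ≤ t * (τ - γ) := by
      linarith
    exact le_of_mul_le_mul_left this ht0
  -- This `ε` makes the error `2 ε ‖d‖` less than half of the assumed gap.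
  have hε := key ((inner ℝ (v - gradient f x) d - (τ - γ)) / (4 * (‖d‖ + 1)))
    (div_pos (by linarith) (by positivity))
  have h3 : (inner ℝ (v - gradient f x) d - (τ - γ)) / (4 * (‖d‖ + 1)) * (4 * (‖d‖ + 1))
      = inner ℝ (v - gradient f x) d - (τ - γ) := div_mul_cancel₀ _ (by positivity)
  have h4 : 0 < (inner ℝ (v - gradient f x) d - (τ - γ)) / (4 * (‖d‖ + 1)) :=
    div_pos (by linarith) (by positivity)
  nlinarith [norm_nonneg d]

theorem IsEpiSubgradient.isRegularSubgradient (hg : ∀ x, g x ≠ ⊥)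
    (hφ : ∀ x, φ x = (f x : EReal) + g x) {x s : EuclideanSpace ℝ (Fin n)} {γ : ℝ}
    (hf : DifferentiableAt ℝ f x) (hγ : g x = γ) (hs : IsEpiSubgradient g x γ s) :
    IsRegularSubgradient φ x (gradient f x + s) := by
  have e : φ x = ((f x + γ : ℝ) : EReal) := by rw [hφ, hγ]; norm_cast
  refine ⟨by rw [e]; exact EReal.coe_ne_bot _, by rw [e]; exact EReal.coe_ne_top _,
    fun ε hε => ?_⟩
  filter_upwards [abs_taylor_gradient_le hf hε] with z hz
  rw [e, hφ z]
  by_cases hzt : g z = ⊤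
  · rw [hzt]; simp
  obtain ⟨τ, hτ⟩ := EReal.exists_real (hg z) hzt
  have h1 := hs z τ hτ.le
  rw [hτ]
  have h2 := (abs_le.1 hz).1
  have : f x + γ + (inner ℝ (gradient f x + s) (z - x) - ε * ‖z - x‖) ≤ f z + τ := by
    rw [inner_add_left]; linarith
  exact_mod_cast this

theorem IsRegularSubgradient.mem_subdiff {h : EuclideanSpace ℝ (Fin n) → EReal}
    {x v : EuclideanSpace ℝ (Fin n)} (hv : IsRegularSubgradient h x v) : v ∈ subdiff h x :=
  ⟨hv.1, hv.2.1, fun _ => x, fun _ => v, fun _ => hv, tendsto_const_nhds, tendsto_const_nhds,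
    tendsto_const_nhds⟩

/-- The epigraph inequality survives limits: `φ(xs k) → φ(x)` and continuity of `f` force the values
of `g` to converge as well. -/
theorem mem_subdiff_add_iff (hf : ContDiff ℝ 2 f) (hg : ∀ x, g x ≠ ⊥)
    (hgp : IsPolyhedralFun g) (hφ : ∀ x, φ x = (f x : EReal) + g x)
    {x v : EuclideanSpace ℝ (Fin n)} {γ : ℝ} (hγ : g x = γ) :
    v ∈ subdiff φ x ↔ IsEpiSubgradient g x γ (v - gradient f x) := by
  have hd : Differentiable ℝ f := hf.differentiable (by norm_num)
  constructor
  · rintro ⟨-, -, xs, vs, hreg, hxs, hφs, hvs⟩ z τ hz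
    have hgc : Continuous (gradient f) := by
      have := hf.continuous_fderiv (by norm_num)
      exact (InnerProductSpace.toDual ℝ (EuclideanSpace ℝ (Fin n))).symm.continuous.comp this
    choose γs hγs hsub using fun k => (hreg k).exists_isEpiSubgradient hd hg hgp hφ
    have e : φ x = ((f x + γ : ℝ) : EReal) := by rw [hφ, hγ]; norm_cast
    have es : ∀ k, φ (xs k) = ((f (xs k) + γs k : ℝ) : EReal) := by
      intro k; rw [hφ, hγs]; norm_cast
    simp only [e, es, EReal.tendsto_coe] at hφs
    have hfx : Tendsto (fun k => f (xs k)) atTop (𝓝 (f x)) := (hd.continuous.tendsto x).comp hxs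
    have hγt : Tendsto γs atTop (𝓝 γ) := by simpa using hφs.sub hfx
    have hl : Tendsto (fun k => γs k + inner ℝ (vs k - gradient f (xs k)) (z - xs k)) atTop
        (𝓝 (γ + inner ℝ (v - gradient f x) (z - x))) :=
      hγt.add ((hvs.sub ((hgc.tendsto x).comp hxs)).inner (tendsto_const_nhds.sub hxs))
    exact le_of_tendsto hl (Eventually.of_forall fun k => hsub k z τ hz)
  · intro h
    have := (h.isRegularSubgradient hg hφ (hd x) hγ).mem_subdiff
    simpa using this

end Sum

/-! ### Local geometry of a polyhedral epigraph -/

/-- Write the normal of an active half-space as `(p, β)`. If `β < 0`, then `p / (-β)` is a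
subgradient, so `p / (-β) - q ∈ L`. If `β = 0`, then `p` is normal to the domain, so `q + p` is a
subgradient and `p ∈ L`. -/
theorem IsPolyhedralFun.eventually_active_eq_zero {n : ℕ}
    {g : EuclideanSpace ℝ (Fin n) → EReal}
    {x₀ q : EuclideanSpace ℝ (Fin n)} {γ : ℝ} (hγ : g x₀ = γ)
    {L : Submodule ℝ (EuclideanSpace ℝ (Fin n))}
    (h0 : IsEpiSubgradient g x₀ γ q) (hL : ∀ s, IsEpiSubgradient g x₀ γ (q + s) → s ∈ L)
    {a : (EuclideanSpace ℝ (Fin n) × ℝ) →ₗ[ℝ] ℝ} {b : ℝ}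
    (ha : ∀ (z : EuclideanSpace ℝ (Fin n)) (τ : ℝ), g z ≤ τ → a (z, τ) ≤ b)
    (hact : a (x₀, γ) = b) :
    a (0, 1) ≤ 0 ∧ ∀ d ∈ Lᗮ, a (d, inner ℝ q d) = 0 := by
  have hadd : ∀ (z w : EuclideanSpace ℝ (Fin n)) (τ ω : ℝ),
      a (z + w, τ + ω) = a (z, τ) + a (w, ω) := fun z w τ ω => by
    rw [← map_add, Prod.mk_add_mk]
  have hdec : ∀ (d : EuclideanSpace ℝ (Fin n)) (τ : ℝ), a (d, τ) = a (d, 0) + τ * a (0, 1) := by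
    intro d τ
    rw [← smul_eq_mul, ← map_smul, ← map_add]; simp
  have hβ : a (0, 1) ≤ 0 := by
    have h1 := ha x₀ (γ + 1) (by rw [hγ]; exact_mod_cast (by linarith))
    have h2 := hadd x₀ 0 γ 1
    rw [add_zero] at h2
    linarith
  refine ⟨hβ, fun d hd => ?_⟩
  set p : EuclideanSpace ℝ (Fin n) := (InnerProductSpace.toDual ℝ _).symm
    (LinearMap.toContinuousLinearMap (a ∘ₗ LinearMap.inl ℝ _ ℝ)) with hp
  have hpd : ∀ w, inner ℝ p w = a (w, 0) := by
    intro w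
    rw [hp, InnerProductSpace.toDual_symm_apply]; rfl
  have hcone : ∀ (z : EuclideanSpace ℝ (Fin n)) (τ : ℝ), g z ≤ τ →
      inner ℝ p (z - x₀) + (τ - γ) * a (0, 1) ≤ 0 := by
    intro z τ hz
    have h1 := ha z τ hz
    have h2 := hadd x₀ (z - x₀) γ (τ - γ)
    rw [add_sub_cancel, add_sub_cancel, hdec (z - x₀)] at h2
    rw [hpd]; linarith
  rw [hdec, ← hpd]
  have horth : ∀ s ∈ L, inner ℝ s d = 0 := fun s hs => (Submodule.mem_orthogonal L d).1 hd s hs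
  rcases hβ.lt_or_eq with hneg | hz
  · have hs : (-a (0, 1))⁻¹ • p - q ∈ L := by
      apply hL
      intro z τ hz
      have h1 := hcone z τ hz
      rw [add_sub_cancel, real_inner_smul_left]
      have h2 : (-a (0, 1))⁻¹ * inner ℝ p (z - x₀) ≤ τ - γ := by
        rw [inv_mul_le_iff₀ (by linarith)]; linarith
      linarith
    have h3 := horth _ hs
    rw [inner_sub_left, real_inner_smul_left, sub_eq_zero, inv_mul_eq_iff_eq_mul₀ (by linarith)] at h3
    rw [h3]; ring
  · have hs : p ∈ L := by
      apply hL
      intro z τ hzτ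
      have h1 := hcone z τ hzτ
      rw [hz] at h1
      have h2 := h0 z τ hzτ
      rw [inner_add_left]; linarith
    rw [hz, horth _ hs]; ring

/-- Near `(x₀, γ)`, the epigraph of a polyhedral function is invariant under translations
along `(d, ⟨q, d⟩)` with `d` orthogonal to all subgradient differences. -/
theorem IsPolyhedralFun.eventually_le_translate {n : ℕ}
    {g : EuclideanSpace ℝ (Fin n) → EReal} (hgp : IsPolyhedralFun g)
    {x₀ q : EuclideanSpace ℝ (Fin n)} {γ : ℝ} (hγ : g x₀ = γ)
    {L : Submodule ℝ (EuclideanSpace ℝ (Fin n))}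
    (h0 : IsEpiSubgradient g x₀ γ q) (hL : ∀ s, IsEpiSubgradient g x₀ γ (q + s) → s ∈ L) :
    ∃ ρ > 0, ∀ (x d : EuclideanSpace ℝ (Fin n)) (τ : ℝ), ‖x - x₀‖ < ρ → |τ - γ| < ρ → ‖d‖ < ρ →
      d ∈ Lᗮ → g x ≤ τ → g (x + d) ≤ ((τ + inner ℝ q d : ℝ) : EReal) := by
  obtain ⟨m, a, b, h⟩ := hgp
  have mem : ∀ (w : EuclideanSpace ℝ (Fin n)) (ω : ℝ), g w ≤ ω ↔ ∀ i, a i (w, ω) ≤ b i :=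
    fun w ω => Set.ext_iff.1 h (w, ω)
  have ev : ∀ i, ∀ᶠ p : EuclideanSpace ℝ (Fin n) × ℝ × EuclideanSpace ℝ (Fin n) in
      𝓝 (x₀, γ, 0), p.2.2 ∈ Lᗮ → g p.1 ≤ (p.2.1 : EReal) →
        a i (p.1 + p.2.2, p.2.1 + inner ℝ q p.2.2) ≤ b i := by
    intro i
    have hle : a i (x₀, γ) ≤ b i := (mem x₀ γ).1 hγ.le i
    -- Inactive constraints persist by continuity; active ones do not see the translation at all.
    rcases hle.lt_or_eq with hlt | heq
    · have hac : Continuous (a i) := LinearMap.continuous_of_finiteDimensional _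
      have hc : Continuous fun p : EuclideanSpace ℝ (Fin n) × ℝ × EuclideanSpace ℝ (Fin n) =>
          a i (p.1 + p.2.2, p.2.1 + inner ℝ q p.2.2) := by fun_prop
      have := hc.tendsto (x₀, γ, 0)
      simp only [add_zero, inner_zero_right] at this
      filter_upwards [this.eventually_lt_const hlt] with p hp _ _ using hp.le
    · refine Eventually.of_forall fun p hd hp => ?_
      have h1 := (eventually_active_eq_zero hγ h0 hL (a := a i) (b := b i)
        (fun z τ hz => (mem z τ).1 hz i) heq).2 p.2.2 hd
      rw [← Prod.mk_add_mk, map_add, h1, add_zero]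
      exact (mem _ _).1 hp i
  obtain ⟨ρ, hρ, hball⟩ := Metric.eventually_nhds_iff.1 (eventually_all.2 ev)
  refine ⟨ρ, hρ, fun x d τ hx hτ hd hdL hg => ?_⟩
  rw [mem]
  intro i
  refine hball (y := (x, τ, d)) ?_ i hdL hg
  simp only [Prod.dist_eq, max_lt_iff]
  simp only [dist_eq_norm, sub_zero, Real.norm_eq_abs]
  exact ⟨hx, hτ, hd⟩

/-- On its domain, a polyhedral function grows at most linearly in the directions of its
subgradient differences, near a given point. -/
theorem IsPolyhedralFun.eventually_le_linear {n : ℕ}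
    {g : EuclideanSpace ℝ (Fin n) → EReal} (hgp : IsPolyhedralFun g) (hgb : ∀ x, g x ≠ ⊥)
    {x₀ q : EuclideanSpace ℝ (Fin n)} {γ : ℝ} (hγ : g x₀ = γ)
    {L : Submodule ℝ (EuclideanSpace ℝ (Fin n))}
    (h0 : IsEpiSubgradient g x₀ γ q) (hL : ∀ s, IsEpiSubgradient g x₀ γ (q + s) → s ∈ L) :
    ∃ C ≥ 0, ∀ᶠ x in 𝓝 x₀, g x ≠ ⊤ →
      g x ≤ ((γ + inner ℝ q (x - x₀) + C * ‖L.starProjection (x - x₀)‖ : ℝ) : EReal) := by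
  obtain ⟨m, a, b, h⟩ := hgp
  have mem : ∀ (w : EuclideanSpace ℝ (Fin n)) (ω : ℝ), g w ≤ ω ↔ ∀ i, a i (w, ω) ≤ b i :=
    fun w ω => Set.ext_iff.1 h (w, ω)
  let M : Fin m → (EuclideanSpace ℝ (Fin n) →L[ℝ] ℝ) := fun i => LinearMap.toContinuousLinearMap
    (a i ∘ₗ LinearMap.prod LinearMap.id (innerSL ℝ q).toLinearMap)
  have hM : ∀ i d, M i d = a i (d, inner ℝ q d) := fun i d => rfl
  -- Each nonvertical constraint allows the slope `‖M i‖ / |a i (0, 1)|`; the sum dominates them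
  -- all. Vertical ones contribute `0`, the value of division by zero.
  set C : ℝ := ∑ i, ‖M i‖ / |a i (0, 1)| with hC
  have hC0 : 0 ≤ C := Finset.sum_nonneg fun i _ => by positivity
  refine ⟨C, hC0, ?_⟩
  have ev : ∀ i, ∀ᶠ x in 𝓝 x₀, g x ≠ ⊤ →
      a i (x, γ + inner ℝ q (x - x₀) + C * ‖L.starProjection (x - x₀)‖) ≤ b i := by
    intro i
    have hle : a i (x₀, γ) ≤ b i := (mem x₀ γ).1 hγ.le i
    rcases hle.lt_or_eq with hlt | heq
    · have hac : Continuous (a i) := LinearMap.continuous_of_finiteDimensional _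
      have hc : Continuous fun x =>
          a i (x, γ + inner ℝ q (x - x₀) + C * ‖L.starProjection (x - x₀)‖) := by fun_prop
      have := hc.tendsto x₀
      simp only [sub_self, map_zero, norm_zero, mul_zero, add_zero, inner_zero_right] at this
      filter_upwards [this.eventually_lt_const hlt] with p hp _ using hp.le
    · refine Eventually.of_forall fun x hx => ?_
      obtain ⟨hβ, hv⟩ := eventually_active_eq_zero hγ h0 hL (a := a i) (b := b i)
        (fun z τ hz => (mem z τ).1 hz i) heq
      rcases hβ.lt_or_eq with hneg | hz
      · have e : ((x, γ + inner ℝ q (x - x₀) + C * ‖L.starProjection (x - x₀)‖) :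
            EuclideanSpace ℝ (Fin n) × ℝ) = (x₀, γ) + (x - x₀, inner ℝ q (x - x₀))
            + (C * ‖L.starProjection (x - x₀)‖) • (0, 1) := by
          ext1 <;> simp
        have hMp : M i (x - x₀) = M i (L.starProjection (x - x₀)) := by
          rw [← sub_eq_zero, ← map_sub, hM]
          exact hv _ (Submodule.sub_starProjection_mem_orthogonal _)
        have h1 := (le_abs_self _).trans ((M i).le_opNorm (L.starProjection (x - x₀)))
        have h2 : ‖M i‖ ≤ C * |a i (0, 1)| := by
          rw [← div_le_iff₀ (abs_pos.2 hneg.ne)]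
          exact Finset.single_le_sum (f := fun i => ‖M i‖ / |a i (0, 1)|)
            (fun i _ => by positivity) (Finset.mem_univ i)
        rw [abs_of_neg hneg] at h2
        rw [e, map_add, map_add, map_smul, smul_eq_mul, heq, ← hM, hMp]
        nlinarith [mul_le_mul_of_nonneg_right h2 (norm_nonneg (L.starProjection (x - x₀)))]
      -- A vertical half-space ignores the height, so `x ∈ dom g` suffices.
      · obtain ⟨τ, hτ⟩ := EReal.exists_real (hgb x) hx
        have h1 := (mem x τ).1 hτ.le i
        have e : ∀ ω : ℝ, a i (x, ω) = a i (x, 0) := by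
          intro ω
          have : ((x, ω) : EuclideanSpace ℝ (Fin n) × ℝ) = (x, 0) + ω • (0, 1) := by
            ext1 <;> simp
          rw [this, map_add, map_smul, hz, smul_zero, add_zero]
        rw [e] at h1 ⊢
        exact h1
  filter_upwards [eventually_all.2 ev] with x hx hxt
  exact (mem _ _).2 fun i => hx i hxt

/-! ### First-order tests along square-root curves -/

theorem IsRegularSubgradient.inner_le_of_curve {n : ℕ}
    {h : EuclideanSpace ℝ (Fin n) → EReal} {y v w : EuclideanSpace ℝ (Fin n)}
    (hv : IsRegularSubgradient h y v) {c : ℝ → EuclideanSpace ℝ (Fin n)}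
    (hc : HasDerivAt c w 0) (hc0 : c 0 = y) {θ : ℝ → ℝ} {M : ℝ} (hθ : HasDerivAt θ M 0)
    (hθ0 : θ 0 = 0) (hle : ∀ᶠ t in 𝓝[>] (0 : ℝ), h (c t) ≤ h y + (θ t : ℝ)) :
    inner ℝ v w ≤ M := by
  obtain ⟨hb, ht, hv⟩ := hv
  obtain ⟨η, hη⟩ := EReal.exists_real hb ht
  have key : ∀ ε : ℝ, 0 < ε → inner ℝ v w - ε * ‖w‖ ≤ M := by
    intro ε hε
    have hct : Tendsto c (𝓝[>] 0) (𝓝 y) := by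
      have := hc.continuousAt.tendsto.mono_left (nhdsWithin_le_nhds (s := Set.Ioi (0 : ℝ)))
      rwa [hc0] at this
    have hsc := hc.tendsto_slope_zero_right
    have hsθ := hθ.tendsto_slope_zero_right
    simp only [zero_add, hc0, hθ0, sub_zero] at hsc hsθ
    refine le_of_tendsto_of_tendsto
      ((tendsto_const_nhds.inner hsc).sub (tendsto_const_nhds.mul hsc.norm)) hsθ ?_
    filter_upwards [hct.eventually (hv ε hε), hle, self_mem_nhdsWithin] with t h1 h2 ht
    have h3 := h1.trans h2
    rw [hη] at h3
    have h4 : η + (inner ℝ v (c t - y) - ε * ‖c t - y‖) ≤ η + θ t := by exact_mod_cast h3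
    have ht' : 0 < t⁻¹ := inv_pos.2 ht
    rw [real_inner_smul_right, norm_smul, Real.norm_of_nonneg ht'.le, smul_eq_mul]
    nlinarith [mul_le_mul_of_nonneg_left (show inner ℝ v (c t - y) - ε * ‖c t - y‖ ≤ θ t by
      linarith) ht'.le]
  have hlim : Tendsto (fun ε : ℝ => inner ℝ v w - ε * ‖w‖) (𝓝[>] 0) (𝓝 (inner ℝ v w)) := by
    have : Continuous fun ε : ℝ => inner ℝ v w - ε * ‖w‖ := by fun_prop
    simpa using (this.tendsto 0).mono_left (nhdsWithin_le_nhds (s := Set.Ioi (0 : ℝ)))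
  exact le_of_tendsto hlim (by filter_upwards [self_mem_nhdsWithin] with ε hε using key ε hε)

theorem sqMap_apply {n : ℕ} (y : EuclideanSpace ℝ (Fin n)) (i : Fin n) :
    sqMap y i = y i ^ 2 := rfl

theorem continuous_sqMap {n : ℕ} : Continuous (sqMap (n := n)) := by
  unfold sqMap; fun_prop

/-- The curve through `y` whose componentwise square is the ray `t ↦ y² + t d`. -/
noncomputable def sqrtRay {n : ℕ} (y d : EuclideanSpace ℝ (Fin n)) (t : ℝ) :
    EuclideanSpace ℝ (Fin n) :=
  WithLp.toLp 2 fun i => y i * √(1 + t * (d i / y i ^ 2))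

/-- The velocity of `sqrtRay y d` at `t = 0`. -/
noncomputable def sqrtRayVelocity {n : ℕ} (y d : EuclideanSpace ℝ (Fin n)) :
    EuclideanSpace ℝ (Fin n) :=
  WithLp.toLp 2 fun i => d i / (2 * y i)

theorem sqrtRay_zero {n : ℕ} (y d : EuclideanSpace ℝ (Fin n)) : sqrtRay y d 0 = y := by
  ext i; simp [sqrtRay]

theorem hasDerivAt_sqrtRay {n : ℕ} (y d : EuclideanSpace ℝ (Fin n)) :
    HasDerivAt (sqrtRay y d) (sqrtRayVelocity y d) 0 := by
  suffices key : HasDerivAt (fun (t : ℝ) (i : Fin n) => y i * √(1 + t * (d i / y i ^ 2)))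
      (fun i => d i / (2 * y i)) 0 by
    have := (PiLp.hasFDerivAt_toLp (𝕜 := ℝ) 2
      (fun i => y i * √(1 + 0 * (d i / y i ^ 2)))).comp_hasDerivAt (0 : ℝ) key
    exact this
  refine hasDerivAt_pi.2 fun i => ?_
  have h1 : HasDerivAt (fun t : ℝ => 1 + t * (d i / y i ^ 2)) (d i / y i ^ 2) 0 := by
    simpa using ((hasDerivAt_id (0 : ℝ)).mul_const (d i / y i ^ 2)).const_add 1
  have h2 := (h1.sqrt (by simp)).const_mul (y i)
  have e : y i * (d i / y i ^ 2 / (2 * √(1 + 0 * (d i / y i ^ 2)))) = d i / (2 * y i) := by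
    -- At a zero coordinate both sides are `0`, division by zero being `0`.
    by_cases hy : y i = 0
    · simp [hy]
    · simp; field_simp
  rwa [e] at h2

theorem eventually_sqMap_sqrtRay {n : ℕ} {y d : EuclideanSpace ℝ (Fin n)}
    (hd : ∀ i, y i = 0 → d i = 0) :
    ∀ᶠ t in 𝓝 (0 : ℝ), sqMap (sqrtRay y d t) = sqMap y + t • d := by
  have h : ∀ᶠ t in 𝓝 (0 : ℝ), ∀ i, 0 ≤ 1 + t * (d i / y i ^ 2) := by
    refine eventually_all.2 fun i => ?_
    have : Continuous fun t : ℝ => 1 + t * (d i / y i ^ 2) := by fun_prop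
    have h2 := this.tendsto 0
    simp only [zero_mul, add_zero] at h2
    filter_upwards [h2.eventually_const_lt zero_lt_one] with t ht using ht.le
  filter_upwards [h] with t ht
  ext i
  simp only [sqMap_apply, sqrtRay, PiLp.add_apply, PiLp.smul_apply, smul_eq_mul]
  rw [mul_pow, Real.sq_sqrt (ht i)]
  by_cases hy : y i = 0
  · simp [hy, hd i hy]
  · field_simp

/-- First-order condition for a regular subgradient of `y ↦ f(y²) + g(y²)` along directions
supported on the support of `y`. -/
theorem IsRegularSubgradient.inner_sqrtRayVelocity_le {n : ℕ} {f : EuclideanSpace ℝ (Fin n) → ℝ}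
    {g Φ : EuclideanSpace ℝ (Fin n) → EReal} (hf : Differentiable ℝ f)
    (hΦ : ∀ y, Φ y = (f (sqMap y) : EReal) + g (sqMap y))
    {y v d : EuclideanSpace ℝ (Fin n)} (hv : IsRegularSubgradient Φ y v) {γ κ : ℝ}
    (hγ : g (sqMap y) = γ) (hd : ∀ i, y i = 0 → d i = 0)
    (hκ : ∀ᶠ t in 𝓝[>] (0 : ℝ), g (sqMap y + t • d) ≤ ((γ + t * κ : ℝ) : EReal)) :
    inner ℝ v (sqrtRayVelocity y d) ≤ inner ℝ (gradient f (sqMap y)) d + κ := by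
  have h1 : HasDerivAt (fun t : ℝ => sqMap y + t • d) d 0 := by
    simpa using ((hasDerivAt_id (0 : ℝ)).smul_const d).const_add (sqMap y)
  have h2 : HasDerivAt (fun t : ℝ => f (sqMap y + t • d)) (inner ℝ (gradient f (sqMap y)) d) 0 := by
    have := (hf (sqMap y + (0 : ℝ) • d)).hasFDerivAt.comp_hasDerivAt (0 : ℝ) h1
    simpa [gradient, Function.comp_def] using this
  have h3 : HasDerivAt (fun t : ℝ => f (sqMap y + t • d) - f (sqMap y) + t * κ)
      (inner ℝ (gradient f (sqMap y)) d + κ) 0 := by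
    have := (h2.sub_const (f (sqMap y))).add ((hasDerivAt_id (0 : ℝ)).mul_const κ)
    rwa [one_mul] at this
  refine hv.inner_le_of_curve (hasDerivAt_sqrtRay y d) (sqrtRay_zero y d) h3 (by simp) ?_
  filter_upwards [hκ, nhdsWithin_le_nhds (eventually_sqMap_sqrtRay hd)] with t ht1 ht2
  rw [hΦ, hΦ, ht2, hγ]
  refine (add_le_add_right ht1 _).trans (le_of_eq ?_)
  norm_cast
  ring

/-! ### The KL inequality as a power bound -/

theorem isDesingularizing_rpow {a c β : ℝ} (hc : 0 < c) (hβ0 : 0 ≤ β) (hβ1 : β < 1) :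
    IsDesingularizing (a : EReal) (fun s => c * s ^ (1 - β)) := by
  have hd : ∀ s : ℝ, 0 < s → HasDerivAt (fun s : ℝ => c * s ^ (1 - β))
      (c * ((1 - β) * s ^ (-β))) s := by
    intro s hs
    have := (Real.hasDerivAt_rpow_const (p := 1 - β) (Or.inl hs.ne')).const_mul c
    simpa using this
  have hset : {s : ℝ | 0 ≤ s ∧ (s : EReal) < a} = Set.Ico 0 a := by
    ext s; simp
  refine ⟨by simp [Real.zero_rpow (sub_pos.2 hβ1).ne'],
    fun s hs _ => mul_nonneg hc.le (Real.rpow_nonneg hs _), ?_, ?_, ?_, ?_, ?_⟩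
  · exact (continuous_const.mul
      (Real.continuous_rpow_const (sub_pos.2 hβ1).le)).continuousOn
  · rw [hset]
    exact ((Real.concaveOn_rpow (sub_pos.2 hβ1).le (by linarith)).subset
      Set.Ico_subset_Ici_self (convex_Ico 0 a)).smul hc.le
  · exact fun s hs => (hd s hs.1).differentiableAt.differentiableWithinAt
  · refine ContinuousOn.congr (f := fun s => c * ((1 - β) * s ^ (-β))) ?_
      fun s hs => (hd s hs.1).deriv
    exact fun s hs => (continuousAt_const.mul (continuousAt_const.mul
      (Real.continuousAt_rpow_const _ _ (Or.inl hs.1.ne')))).continuousWithinAt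
  · intro s hs _
    rw [(hd s hs).deriv]
    exact mul_pos hc (mul_pos (sub_pos.2 hβ1) (Real.rpow_pos_of_pos hs _))

theorem deriv_mul_rpow {c β s : ℝ} (hs : 0 < s) :
    deriv (fun s : ℝ => c * s ^ (1 - β)) s = c * (1 - β) / s ^ β := by
  have := (Real.hasDerivAt_rpow_const (p := 1 - β) (Or.inl hs.ne')).const_mul c
  rw [this.deriv, show 1 - β - 1 = -β by ring, Real.rpow_neg hs.le]
  ring

/-- The KL inequality may be tested on regular subgradients. -/
theorem HasKLExponent.of_regular {n : ℕ} {h : EuclideanSpace ℝ (Fin n) → EReal}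
    {x₀ : EuclideanSpace ℝ (Fin n)} (hp : ProperFun h) (hl : LowerSemicontinuous h)
    (hne : (subdiff h x₀).Nonempty) {β : ℝ} (hβ0 : 0 ≤ β) (hβ1 : β < 1) {η : ℝ}
    (hη : h x₀ = η) {K a : ℝ} (hK : 0 < K) (ha : 0 < a)
    (hreg : ∀ᶠ x in 𝓝 x₀, ∀ r : ℝ, h x = r → 0 < r - η → r - η < a →
      ∀ v, IsRegularSubgradient h x v → (r - η) ^ β ≤ K * ‖v‖) :
    HasKLExponent h x₀ β := by
  have hβ : 0 < 1 - β := sub_pos.2 hβ1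
  -- The factor `1 / (1 - β)` cancels the one from differentiating the power. The neighborhood
  -- consists of points near which `hreg` still holds, so that it applies along sequences converging
  -- to them.
  refine ⟨hβ0, hβ1, K / (1 - β), by positivity, hp, hl, hne, a, by exact_mod_cast ha,
    isDesingularizing_rpow (by positivity) hβ0 hβ1, _, eventually_eventually_nhds.2 hreg, ?_⟩
  intro x hx h0 h1
  have hxt : h x ≠ ⊤ := by
    intro ht; rw [ht, hη] at h1; simp at h1
  obtain ⟨r, hr⟩ := EReal.exists_real (hp.1 x) hxt
  rw [hr, hη, ← EReal.coe_sub] at h0 h1 ⊢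
  have h0' : 0 < r - η := by exact_mod_cast h0
  have h1' : r - η < a := by exact_mod_cast h1
  rw [EReal.toReal_coe, deriv_mul_rpow h0', div_mul_cancel₀ _ hβ.ne']
  have hpow : 0 < (r - η) ^ β := Real.rpow_pos_of_pos h0' _
  have key : ∀ v ∈ subdiff h x, (r - η) ^ β ≤ K * ‖v‖ := by
    rintro v ⟨-, -, xs, vs, hvs, hxs, hhs, hvl⟩
    choose rs hrs using fun k => EReal.exists_real (hvs k).1 (hvs k).2.1
    simp only [hrs, hr, EReal.tendsto_coe] at hhs
    have hd : Tendsto (fun k => rs k - η) atTop (𝓝 (r - η)) := hhs.sub_const η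
    refine le_of_tendsto_of_tendsto (hd.rpow_const (Or.inl h0'.ne')) (hvl.norm.const_mul K) ?_
    filter_upwards [hxs.eventually hx, hd.eventually_const_lt h0', hd.eventually_lt_const h1']
      with k k1 k2 k3 using k1 _ (hrs k) k2 k3 _ (hvs k)
  have hdist : ENNReal.ofReal ((r - η) ^ β / K) ≤ Metric.infEDist 0 (subdiff h x) := by
    refine Metric.le_infEDist.2 fun v hv => ?_
    rw [edist_comm, edist_zero_right, ← ofReal_norm]
    refine ENNReal.ofReal_le_ofReal ?_
    rw [div_le_iff₀' hK]
    exact key v hv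
  calc (1 : ℝ≥0∞) = ENNReal.ofReal (K / (r - η) ^ β) * ENNReal.ofReal ((r - η) ^ β / K) := by
        rw [← ENNReal.ofReal_mul (by positivity), div_mul_div_cancel₀ hpow.ne', div_self hK.ne',
          ENNReal.ofReal_one]
    _ ≤ _ := by gcongr

theorem HasKLExponent.exists_le {n : ℕ} {h : EuclideanSpace ℝ (Fin n) → EReal}
    {x₀ : EuclideanSpace ℝ (Fin n)} {β η : ℝ} (hη : h x₀ = η) (hh : HasKLExponent h x₀ β) :
    ∃ K > 0, ∃ a > 0, ∀ᶠ x in 𝓝 x₀, ∀ r : ℝ, h x = r → 0 < r - η → r - η < a →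
      ∀ v ∈ subdiff h x, (r - η) ^ β ≤ K * ‖v‖ := by
  obtain ⟨hβ0, hβ1, c, hc, -, -, -, a, ha, -, V, hV, hkl⟩ := hh
  obtain ⟨a', ha'0, ha'⟩ := EReal.lt_iff_exists_real_btwn.1 ha
  have hβ : 0 < 1 - β := sub_pos.2 hβ1
  refine ⟨c * (1 - β), by positivity, a', by exact_mod_cast ha'0, ?_⟩
  filter_upwards [hV] with x hx r hr h0 h1 v hv
  have hpow : 0 < (r - η) ^ β := Real.rpow_pos_of_pos h0 _
  have h2 := hkl x hx
  rw [hr, hη, ← EReal.coe_sub, EReal.toReal_coe, deriv_mul_rpow h0] at h2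
  have h3 := h2 (by exact_mod_cast h0) (lt_trans (by exact_mod_cast h1) ha')
  have h4 : Metric.infEDist 0 (subdiff h x) ≤ ENNReal.ofReal ‖v‖ := by
    refine (Metric.infEDist_le_edist_of_mem hv).trans (le_of_eq ?_)
    rw [edist_comm, edist_zero_right, ← ofReal_norm]
  have h5 := h3.trans (mul_le_mul_right h4 _)
  rw [← ENNReal.ofReal_mul (by positivity), ENNReal.one_le_ofReal, div_mul_eq_mul_div,
    one_le_div hpow] at h5
  exact h5

/-! ### Relative interior, projections and the two estimates on `v` -/

/-- Since `0 ∈ S`, the affine span of `S` is its linear span. -/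
theorem exists_forall_mem_span_of_mem_intrinsicInterior {n : ℕ}
    {S : Set (EuclideanSpace ℝ (Fin n))} (h : 0 ∈ intrinsicInterior ℝ S) :
    ∃ ε > 0, ∀ s ∈ Submodule.span ℝ S, ‖s‖ ≤ ε → s ∈ S := by
  have h0 : (0 : EuclideanSpace ℝ (Fin n)) ∈ S := intrinsicInterior_subset h
  obtain ⟨y, hy, hy0⟩ := mem_intrinsicInterior.1 h
  obtain ⟨ε, hε, hb⟩ := Metric.mem_nhds_iff.1 (mem_interior_iff_mem_nhds.1 hy)
  refine ⟨ε / 2, by positivity, fun s hs hn => ?_⟩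
  have hmem : s ∈ affineSpan ℝ S := by
    have : (affineSpan ℝ (insert 0 S) : Set (EuclideanSpace ℝ (Fin n))) = Submodule.span ℝ S :=
      affineSpan_insert_zero S
    rw [Set.insert_eq_of_mem h0] at this
    rw [← SetLike.mem_coe, this]
    exact hs
  have : (⟨s, hmem⟩ : affineSpan ℝ S) ∈ Metric.ball y ε := by
    rw [Metric.mem_ball, Subtype.dist_eq, hy0, dist_zero_right]
    exact hn.trans_lt (by linarith)
  exact hb this

theorem norm_le_sqrt_mul_of_forall_abs_le {n : ℕ} {w : EuclideanSpace ℝ (Fin n)} {M : ℝ}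
    (hM : 0 ≤ M) (h : ∀ i, |w i| ≤ M) : ‖w‖ ≤ √n * M := by
  refine abs_le_of_sq_le_sq' ?_ (by positivity) |>.2
  rw [EuclideanSpace.norm_sq_eq, mul_pow, Real.sq_sqrt (Nat.cast_nonneg n)]
  calc ∑ i, ‖w i‖ ^ 2 ≤ ∑ _i : Fin n, M ^ 2 :=
        Finset.sum_le_sum fun i _ => pow_le_pow_left₀ (norm_nonneg _) (h i) 2
    _ = n * M ^ 2 := by simp

theorem real_inner_starProjection_self {n : ℕ} (L : Submodule ℝ (EuclideanSpace ℝ (Fin n)))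
    (w : EuclideanSpace ℝ (Fin n)) : inner ℝ (L.starProjection w) w = ‖L.starProjection w‖ ^ 2 := by
  have h := (Submodule.mem_orthogonal L _).1 (Submodule.sub_starProjection_mem_orthogonal w)
    _ (Submodule.starProjection_apply_mem L w)
  rw [inner_sub_right, sub_eq_zero] at h
  rw [h, real_inner_self_eq_norm_sq]

theorem norm_sub_starProjection_le {n : ℕ} (L : Submodule ℝ (EuclideanSpace ℝ (Fin n)))
    (w : EuclideanSpace ℝ (Fin n)) : ‖w - L.starProjection w‖ ≤ ‖w‖ := by
  rw [← Submodule.starProjection_orthogonal_val]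
  exact Submodule.norm_starProjection_apply_le _ _

theorem starProjection_apply_eq {n : ℕ} {L : Submodule ℝ (EuclideanSpace ℝ (Fin n))} {i : Fin n}
    (hi : EuclideanSpace.single i (1 : ℝ) ∈ L) (w : EuclideanSpace ℝ (Fin n)) :
    (L.starProjection w) i = w i := by
  have h := (Submodule.mem_orthogonal L _).1 (Submodule.sub_starProjection_mem_orthogonal w) _ hi
  rw [EuclideanSpace.inner_single_left] at h
  simp at h
  linarith

/-- With a zero linear term, the local Lipschitz bound on `sqMap` is enough. This yields `∂Φ(y₀) ≠
∅`. -/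
theorem isRegularSubgradient_zero_comp_sqMap {n : ℕ} {φ : EuclideanSpace ℝ (Fin n) → EReal}
    {y : EuclideanSpace ℝ (Fin n)} (h : IsRegularSubgradient φ (sqMap y) 0) :
    IsRegularSubgradient (fun z => φ (sqMap z)) y 0 := by
  refine ⟨h.1, h.2.1, fun ε hε => ?_⟩
  have hc : ContDiff ℝ 1 (sqMap (n := n)) :=
    contDiff_euclidean.2 fun i => by
      simp only [sqMap_apply]; fun_prop
  obtain ⟨K, t, ht, hK⟩ := hc.contDiffAt.exists_lipschitzOnWith (x := y)
  have h1 := continuous_sqMap.continuousAt.eventually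
    (h.2.2 (ε / (K + 1)) (by positivity))
  filter_upwards [h1, ht] with z hz1 hz2
  refine le_trans (add_le_add_right ?_ _) hz1
  rw [EReal.coe_le_coe_iff, inner_zero_left, inner_zero_left]
  have h2 := hK.dist_le_mul z hz2 y (mem_of_mem_nhds ht)
  rw [dist_eq_norm, dist_eq_norm] at h2
  have h3 : ε / (K + 1) * ‖sqMap z - sqMap y‖ ≤ ε / (K + 1) * ((K + 1) * ‖z - y‖) := by
    gcongr
    nlinarith [norm_nonneg (z - y)]
  rw [← mul_assoc, div_mul_cancel₀ _ (by positivity)] at h3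
  linarith

/-- Sharpness of `φ` in the direction `u` bounds subgradients of `Φ` below by `√‖u‖`. -/
theorem IsRegularSubgradient.sqrt_norm_le {n : ℕ} {f : EuclideanSpace ℝ (Fin n) → ℝ}
    {g Φ : EuclideanSpace ℝ (Fin n) → EReal} (hf : Differentiable ℝ f)
    (hgp : IsPolyhedralFun g) (hΦ : ∀ y, Φ y = (f (sqMap y) : EReal) + g (sqMap y))
    {y v u q : EuclideanSpace ℝ (Fin n)} (hv : IsRegularSubgradient Φ y v) {γ γ' ε A : ℝ}
    (hγ : g (sqMap y) = γ) (hγ' : g (sqMap y - u) ≤ γ')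
    (hsharp : γ' + inner ℝ q u + ε * ‖u‖ ≤ γ) (hq : ‖gradient f (sqMap y) + q‖ ≤ ε / 2)
    (hu : ∀ i, y i = 0 → u i = 0) (hA0 : 0 ≤ A) (hA : ‖sqrtRayVelocity y (-u)‖ ≤ A * √‖u‖) :
    ε / 2 * √‖u‖ ≤ A * ‖v‖ := by
  -- By convexity `g` lies below its chord on the segment towards `sqMap y - u`, which has slope `γ'
  -- - γ`.
  have h1 := hv.inner_sqrtRayVelocity_le hf hΦ hγ (d := -u) (κ := γ' - γ)
    (by simpa using hu) (by
      filter_upwards [Ioo_mem_nhdsGT (zero_lt_one (α := ℝ))] with t ht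
      have := hgp.le_segment hγ.le hγ' ht.1.le ht.2.le
      rwa [sub_sub_cancel_left] at this)
  have h2 : -(‖v‖ * (A * √‖u‖)) ≤ inner ℝ v (sqrtRayVelocity y (-u)) := by
    have := (abs_le.1 (abs_real_inner_le_norm v (sqrtRayVelocity y (-u)))).1
    have := mul_le_mul_of_nonneg_left hA (norm_nonneg v)
    linarith
  have h3 : -(inner ℝ (gradient f (sqMap y) + q) u) ≤ ε / 2 * ‖u‖ := by
    have := (abs_le.1 (abs_real_inner_le_norm (gradient f (sqMap y) + q) u)).1
    have := mul_le_mul_of_nonneg_right hq (norm_nonneg u)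
    linarith
  rw [inner_add_left] at h3
  rw [inner_neg_right] at h1
  have h4 : ε / 2 * ‖u‖ ≤ A * ‖v‖ * √‖u‖ := by linarith
  rcases (Real.sqrt_nonneg ‖u‖).eq_or_lt with h0 | h0
  · rw [← h0, mul_zero]; positivity
  · refine le_of_mul_le_mul_right ?_ h0
    rwa [mul_assoc, Real.mul_self_sqrt (norm_nonneg u)]

/-- Along directions in which `g` is affine, subgradients of `Φ` control the gradient of the
smooth part. -/
theorem IsRegularSubgradient.norm_le_of_affine {n : ℕ} {f : EuclideanSpace ℝ (Fin n) → ℝ}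
    {g Φ : EuclideanSpace ℝ (Fin n) → EReal} (hf : Differentiable ℝ f)
    (hΦ : ∀ y, Φ y = (f (sqMap y) : EReal) + g (sqMap y))
    {y v u q : EuclideanSpace ℝ (Fin n)} (hv : IsRegularSubgradient Φ y v) {γ A : ℝ}
    (hγ : g (sqMap y) = γ)
    (hg : ∀ᶠ t in 𝓝[>] (0 : ℝ), g (sqMap y + t • -u) ≤ ((γ + t * inner ℝ q (-u) : ℝ) : EReal))
    (hq : inner ℝ (gradient f (sqMap y) + q) u = ‖u‖ ^ 2)
    (hu : ∀ i, y i = 0 → u i = 0) (hA0 : 0 ≤ A) (hA : ‖sqrtRayVelocity y (-u)‖ ≤ A * ‖u‖) :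
    ‖u‖ ≤ A * ‖v‖ := by
  have h1 := hv.inner_sqrtRayVelocity_le hf hΦ hγ (d := -u) (by simpa using hu) hg
  have h2 : -(‖v‖ * (A * ‖u‖)) ≤ inner ℝ v (sqrtRayVelocity y (-u)) := by
    have := (abs_le.1 (abs_real_inner_le_norm v (sqrtRayVelocity y (-u)))).1
    have := mul_le_mul_of_nonneg_left hA (norm_nonneg v)
    linarith
  rw [inner_add_left] at hq
  rw [inner_neg_right, inner_neg_right] at h1
  rcases (norm_nonneg u).eq_or_lt with h0 | h0
  · rw [← h0]; positivity
  · refine le_of_mul_le_mul_right ?_ h0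
    nlinarith

/-- The three summands of the constant serve three cases: `v > 1`, where `r ≤ 1` suffices; `r' ≤ r /
2`, where `r ≤ 2 C p`; and `r < 2 r'`, where the KL bound `h4` applies. -/
theorem rpow_max_half_le {α r r' p u u' v ε A C K₁ K₂ : ℝ} (hα0 : 0 < α) (hα1 : α < 1)
    (hr0 : 0 < r) (hr1 : r ≤ 1) (hp : 0 ≤ p) (hv : 0 ≤ v) (hε : 0 < ε) (hA : 0 ≤ A)
    (hC : 0 ≤ C) (hK₁ : 0 ≤ K₁) (hK₂ : 0 ≤ K₂)
    (h1 : ε / 2 * √p ≤ A * v) (h2 : u ≤ A * v) (h3 : r - r' ≤ C * p)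
    (h4 : 0 < r' → r' ^ α ≤ K₁ * u') (h5 : u' ≤ u + K₂ * p) :
    r ^ max α (1 / 2) ≤
      (1 + √(2 * C) * (2 * A / ε) + 2 * K₁ * (A + K₂ * (2 * A / ε) ^ 2)) * v := by
  have hp' : √p ≤ 2 * A / ε * v := by
    rw [div_mul_eq_mul_div, le_div_iff₀ hε]; linarith
  have hb : 0 ≤ 2 * A / ε := by positivity
  set b := 2 * A / ε with hbdef
  have hn1 : 0 ≤ √(2 * C) * b * v := by positivity
  have hn2 : 0 ≤ 2 * K₁ * (A + K₂ * b ^ 2) * v := by positivity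
  rcases lt_or_ge 1 v with hv1 | hv1
  · have : r ^ max α (1 / 2) ≤ 1 := Real.rpow_le_one hr0.le hr1 (by positivity)
    linarith
  rcases le_or_gt r' (r / 2) with hr' | hr'
  · have e1 : r ^ max α (1 / 2) ≤ √r := by
      rw [Real.sqrt_eq_rpow]
      exact Real.rpow_le_rpow_of_exponent_ge hr0 hr1 (le_max_right _ _)
    have e2 : √r ≤ √(2 * C) * √p := by
      rw [← Real.sqrt_mul (by positivity)]
      exact Real.sqrt_le_sqrt (by linarith)
    have e3 := mul_le_mul_of_nonneg_left hp' (Real.sqrt_nonneg (2 * C))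
    linarith
  · have e1 : r ^ max α (1 / 2) ≤ r ^ α :=
      Real.rpow_le_rpow_of_exponent_ge hr0 hr1 (le_max_left _ _)
    have e2 : r ^ α ≤ 2 * r' ^ α := by
      have e3 : r ^ α ≤ (2 * r') ^ α := Real.rpow_le_rpow hr0.le (by linarith) hα0.le
      rw [Real.mul_rpow (by norm_num) (by linarith)] at e3
      have e4 : (2 : ℝ) ^ α ≤ 2 := by
        simpa using Real.rpow_le_rpow_of_exponent_le (one_le_two (α := ℝ)) hα1.le
      exact e3.trans (mul_le_mul_of_nonneg_right e4 (Real.rpow_nonneg (by linarith) _))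
    -- Here `v ≤ 1` lets `v ^ 2` be replaced by `v`.
    have e5 : p ≤ b ^ 2 * v := by
      have : √p * √p ≤ (b * v) * (b * v) :=
        mul_self_le_mul_self (Real.sqrt_nonneg p) hp'
      rw [Real.mul_self_sqrt hp] at this
      nlinarith [mul_nonneg (mul_nonneg hb hb) hv]
    have e6 : u' ≤ (A + K₂ * b ^ 2) * v := by
      have := mul_le_mul_of_nonneg_left e5 hK₂
      linarith
    have e7 := mul_le_mul_of_nonneg_left e6 hK₁
    have := h4 (by linarith)
    linarith

/-! ### Local constants and velocity bounds -/

theorem eventually_inv_two_mul_le {n : ℕ} (y₀ : EuclideanSpace ℝ (Fin n)) :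
    ∃ B ≥ 0, ∀ᶠ y in 𝓝 y₀, ∀ i, y₀ i ≠ 0 → y i ≠ 0 ∧ |2 * y i|⁻¹ ≤ B := by
  refine ⟨1 + ∑ j, |2 * y₀ j|⁻¹, by positivity, eventually_all.2 fun i => ?_⟩
  by_cases hi : y₀ i = 0
  · exact Eventually.of_forall fun y h => absurd hi h
  have hc : Continuous fun y : EuclideanSpace ℝ (Fin n) => y i := by fun_prop
  have hc2 : ContinuousAt (fun y : EuclideanSpace ℝ (Fin n) => |2 * y i|⁻¹) y₀ :=
    ContinuousAt.inv₀ (by fun_prop) (by simpa using hi)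
  have hle : |2 * y₀ i|⁻¹ ≤ ∑ j, |2 * y₀ j|⁻¹ :=
    Finset.single_le_sum (f := fun j => |2 * y₀ j|⁻¹) (fun j _ => by positivity)
      (Finset.mem_univ i)
  filter_upwards [hc.continuousAt.eventually_ne hi,
    hc2.tendsto.eventually_lt_const (show _ < 1 + ∑ j, |2 * y₀ j|⁻¹ by linarith)] with y h1 h2 _
  exact ⟨h1, h2.le⟩

theorem exists_lipschitz_gradient {n : ℕ} {f : EuclideanSpace ℝ (Fin n) → ℝ}
    (hf : ContDiff ℝ 2 f) (x : EuclideanSpace ℝ (Fin n)) :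
    ∃ K ≥ 0, ∃ t ∈ 𝓝 x, ∀ z ∈ t, ∀ w ∈ t,
      |f z - f w| ≤ K * ‖z - w‖ ∧ ‖gradient f z - gradient f w‖ ≤ K * ‖z - w‖ := by
  obtain ⟨K₁, t₁, ht₁, h₁⟩ :=
    (hf.of_le (by norm_num : (1 : WithTop ℕ∞) ≤ 2)).contDiffAt.exists_lipschitzOnWith (x := x)
  obtain ⟨K₂, t₂, ht₂, h₂⟩ :=
    (hf.fderiv_right (m := 1) (by norm_num)).contDiffAt.exists_lipschitzOnWith (x := x)
  refine ⟨K₁ + K₂, by positivity, t₁ ∩ t₂, inter_mem ht₁ ht₂, fun z hz w hw => ⟨?_, ?_⟩⟩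
  · have := h₁.dist_le_mul z hz.1 w hw.1
    rw [dist_eq_norm, dist_eq_norm, Real.norm_eq_abs] at this
    refine this.trans (mul_le_mul_of_nonneg_right ?_ (norm_nonneg _))
    simp
  · have := h₂.dist_le_mul z hz.2 w hw.2
    rw [dist_eq_norm, dist_eq_norm] at this
    simp only [gradient]
    rw [← map_sub, LinearIsometryEquiv.norm_map]
    refine this.trans (mul_le_mul_of_nonneg_right ?_ (norm_nonneg _))
    simp

/-- Where `y₀ i = 0`, the velocity has size `|y i| / 2` while `y i ^ 2 = u i`, hence the square
root. Elsewhere `B` bounds the denominator and `‖u‖ ≤ √‖u‖`. -/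
theorem norm_sqrtRayVelocity_neg_le_sqrt {n : ℕ} {y₀ y u : EuclideanSpace ℝ (Fin n)} {B : ℝ}
    (hB : 0 ≤ B) (hy : ∀ i, y₀ i ≠ 0 → y i ≠ 0 ∧ |2 * y i|⁻¹ ≤ B)
    (hui : ∀ i, y₀ i = 0 → u i = y i ^ 2) (hx2 : ‖u‖ ≤ 1) :
    ‖sqrtRayVelocity y (-u)‖ ≤ √n * (B + 1) * √‖u‖ := by
  rw [mul_assoc]
  refine norm_le_sqrt_mul_of_forall_abs_le (by positivity) fun i => ?_
  have hcoord : |u i| ≤ ‖u‖ := PiLp.norm_apply_le u i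
  have hsq : ‖u‖ ≤ √‖u‖ := Real.le_sqrt_of_sq_le (by nlinarith [norm_nonneg u])
  simp only [sqrtRayVelocity, PiLp.neg_apply]
  rw [abs_div, abs_neg, div_eq_mul_inv]
  by_cases hi : y₀ i = 0
  · rw [hui i hi] at hcoord ⊢
    have h1 : |y i| ≤ √‖u‖ := Real.abs_le_sqrt (by rwa [abs_of_nonneg (sq_nonneg _)] at hcoord)
    have h2 : |y i ^ 2| * |2 * y i|⁻¹ ≤ |y i| := by
      by_cases hyi : y i = 0
      · simp [hyi]
      · rw [abs_pow, abs_mul, abs_two]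
        have : 0 < |y i| := abs_pos.2 hyi
        rw [← div_eq_mul_inv, div_le_iff₀ (by positivity)]
        nlinarith
    nlinarith [mul_nonneg hB (Real.sqrt_nonneg ‖u‖)]
  · have h1 := mul_le_mul (hcoord.trans hsq) (hy i hi).2 (by positivity) (Real.sqrt_nonneg _)
    nlinarith [Real.sqrt_nonneg ‖u‖]

theorem norm_sqrtRayVelocity_neg_le {n : ℕ} {y₀ y w : EuclideanSpace ℝ (Fin n)} {B : ℝ}
    (hB : 0 ≤ B) (hy : ∀ i, y₀ i ≠ 0 → y i ≠ 0 ∧ |2 * y i|⁻¹ ≤ B)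
    (hwi : ∀ i, y₀ i = 0 → w i = 0) :
    ‖sqrtRayVelocity y (-w)‖ ≤ √n * (B + 1) * ‖w‖ := by
  rw [mul_assoc]
  refine norm_le_sqrt_mul_of_forall_abs_le (by positivity) fun i => ?_
  have hcoord : |w i| ≤ ‖w‖ := PiLp.norm_apply_le w i
  simp only [sqrtRayVelocity, PiLp.neg_apply]
  rw [abs_div, abs_neg, div_eq_mul_inv]
  by_cases hi : y₀ i = 0
  · rw [hwi i hi, abs_zero, zero_mul]; positivity
  · have h1 := mul_le_mul hcoord (hy i hi).2 (by positivity) (norm_nonneg _)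
    nlinarith [norm_nonneg w]

/-! ### The main theorem -/

theorem theorem5p12 (n : ℕ) (f : EuclideanSpace ℝ (Fin n) → ℝ) (hf : ContDiff ℝ 2 f)
    (g : EuclideanSpace ℝ (Fin n) → EReal) (hg : ProperFun g) (hgpoly : IsPolyhedralFun g)
    (hgdom : ∀ x, g x < ⊤ → ∀ i, 0 ≤ x i)
    (φ Φ : EuclideanSpace ℝ (Fin n) → EReal)
    (hφ : ∀ x, φ x = (f x : EReal) + g x)
    (hΦ : ∀ y, Φ y = (f (sqMap y) : EReal) + g (sqMap y))
    (x₀ y₀ : EuclideanSpace ℝ (Fin n)) (hxy : x₀ = sqMap y₀)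
    (hri : (0 : EuclideanSpace ℝ (Fin n)) ∈ intrinsicInterior ℝ (subdiff φ x₀))
    (α : ℝ) (hα0 : 0 < α) (hα1 : α < 1) (hKL : HasKLExponent φ x₀ α) :
    HasKLExponent Φ y₀ (max α (1 / 2)) := by
  have hgb := hg.1
  have hd : Differentiable ℝ f := hf.differentiable (by norm_num)
  have hS0 : (0 : EuclideanSpace ℝ (Fin n)) ∈ subdiff φ x₀ := intrinsicInterior_subset hri
  obtain ⟨-, -, -, -, ⟨hproper, hlsc, -⟩⟩ := id hKL
  have hgt : g x₀ ≠ ⊤ := by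
    intro h; have := hS0.2.1; rw [hφ, h] at this; simp at this
  obtain ⟨γ, hγ⟩ := EReal.exists_real (hgb x₀) hgt
  have hη : φ x₀ = ((f x₀ + γ : ℝ) : EReal) := by rw [hφ, hγ]; norm_cast
  have hΦφ : Φ = fun y => φ (sqMap y) := by
    funext y; rw [hΦ, hφ]
  obtain ⟨q, hq⟩ : ∃ q, q = -gradient f x₀ := ⟨_, rfl⟩
  have hS : ∀ s, s ∈ subdiff φ x₀ ↔ IsEpiSubgradient g x₀ γ (q + s) := by
    intro s
    rw [mem_subdiff_add_iff hf hgb hgpoly hφ hγ, hq, neg_add_eq_sub]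
  set L := Submodule.span ℝ (subdiff φ x₀) with hLdef
  have h0 : IsEpiSubgradient g x₀ γ q := by simpa using (hS 0).1 hS0
  have hL : ∀ s, IsEpiSubgradient g x₀ γ (q + s) → s ∈ L :=
    fun s hs => Submodule.subset_span ((hS s).2 hs)
  obtain ⟨ε, hε, hball⟩ := exists_forall_mem_span_of_mem_intrinsicInterior hri
  have hsharp : ∀ (z : EuclideanSpace ℝ (Fin n)) (τ : ℝ), g z ≤ τ →
      γ + inner ℝ q (z - x₀) + ε * ‖L.starProjection (z - x₀)‖ ≤ τ := by
    intro z τ hz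
    set p := L.starProjection (z - x₀) with hp
    rcases (norm_nonneg p).eq_or_lt with hp0 | hp0
    · rw [← hp0, mul_zero, add_zero]; exact h0 z τ hz
    -- The most favorable subgradient is `q` plus the vector of length `ε` along `p`.
    · have hmem : (ε / ‖p‖) • p ∈ L := L.smul_mem _ (Submodule.starProjection_apply_mem L _)
      have h1 := (hS _).1 (hball _ hmem (by
        rw [norm_smul, Real.norm_of_nonneg (by positivity), div_mul_cancel₀ _ hp0.ne'])) z τ hz
      rw [inner_add_left, real_inner_smul_left, hp, real_inner_starProjection_self, ← hp] at h1
      have : ε / ‖p‖ * ‖p‖ ^ 2 = ε * ‖p‖ := by field_simp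
      linarith
  have hsingle : ∀ i, y₀ i = 0 → EuclideanSpace.single i (1 : ℝ) ∈ L := by
    -- The vector `-eᵢ` is normal to the orthant at `x₀`, so `q - eᵢ` is again a subgradient of `g`.
    intro i hi
    rw [← neg_mem_iff]
    refine hL _ fun z τ hz => ?_
    have h1 := hgdom z (hz.trans_lt (EReal.coe_lt_top τ)) i
    have h2 := h0 z τ hz
    rw [inner_add_left, inner_neg_left, EuclideanSpace.inner_single_left]
    have h3 : x₀ i = 0 := by rw [hxy, sqMap_apply, hi]; norm_num
    simp only [map_one, one_mul, PiLp.sub_apply, h3, sub_zero]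
    linarith
  obtain ⟨ρ, hρ, htrans⟩ := hgpoly.eventually_le_translate hγ h0 hL
  obtain ⟨C, hC, hlin⟩ := hgpoly.eventually_le_linear hgb hγ h0 hL
  obtain ⟨K, hK, t, ht, hlip⟩ := exists_lipschitz_gradient hf x₀
  obtain ⟨K₁, hK₁, a, ha, hkl⟩ := hKL.exists_le hη
  obtain ⟨B, hB, hsupp⟩ := eventually_inv_two_mul_le y₀
  have hsqc : Tendsto sqMap (𝓝 y₀) (𝓝 x₀) := hxy ▸ continuous_sqMap.tendsto y₀
  have hgc : Continuous (gradient f) := by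
    have := hf.continuous_fderiv (by norm_num)
    exact (InnerProductSpace.toDual ℝ (EuclideanSpace ℝ (Fin n))).symm.continuous.comp this
  -- the projection onto the affine space through `x₀` orthogonal to `L`
  set T : EuclideanSpace ℝ (Fin n) → EuclideanSpace ℝ (Fin n) :=
    fun x => x - L.starProjection (x - x₀) with hT
  have hTc : Continuous T := by fun_prop
  have hT0 : T x₀ = x₀ := by simp [hT]
  have hTt : Tendsto T (𝓝 x₀) (𝓝 x₀) := by simpa [hT0] using hTc.tendsto x₀
  have hTx : ∀ x, T x - x₀ ∈ Lᗮ := fun x => by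
    have : T x - x₀ = (x - x₀) - L.starProjection (x - x₀) := by simp only [hT]; abel
    rw [this]; exact Submodule.sub_starProjection_mem_orthogonal _
  have hTn : ∀ x, ‖T x - x₀‖ ≤ ‖x - x₀‖ := fun x => by
    have : T x - x₀ = (x - x₀) - L.starProjection (x - x₀) := by simp only [hT]; abel
    rw [this]; exact norm_sub_starProjection_le _ _
  have hnear : ∀ᶠ x in 𝓝 x₀, ‖x - x₀‖ < ρ := by
    have : Continuous fun x : EuclideanSpace ℝ (Fin n) => ‖x - x₀‖ := by fun_prop
    exact (this.tendsto' x₀ 0 (by simp)).eventually_lt_const hρ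
  have hproj : ∀ᶠ x in 𝓝 x₀, ‖L.starProjection (x - x₀)‖ < 1 := by
    have : Continuous fun x => ‖L.starProjection (x - x₀)‖ := by fun_prop
    exact (this.tendsto' x₀ 0 (by simp)).eventually_lt_const one_pos
  have hgrad : ∀ᶠ x in 𝓝 x₀, ‖gradient f x + q‖ < ε / 2 := by
    have : Continuous fun x => ‖gradient f x + q‖ := by fun_prop
    exact (this.tendsto' x₀ 0 (by simp [hq])).eventually_lt_const (by positivity)
  have hval : ∀ᶠ x in 𝓝 x₀, |inner ℝ q (x - x₀)| + C * ‖L.starProjection (x - x₀)‖ < ρ := by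
    have : Continuous fun x => |inner ℝ q (x - x₀)| + C * ‖L.starProjection (x - x₀)‖ := by
      fun_prop
    exact (this.tendsto' x₀ 0 (by simp)).eventually_lt_const hρ
  -- At `T x` this expression equals `φ(T x) - φ(x₀)`, which must stay below the KL threshold `a`.
  have hfval : ∀ᶠ x in 𝓝 x₀, f x - f x₀ + inner ℝ q (x - x₀) < a := by
    have hfc := hd.continuous
    have : Continuous fun x => f x - f x₀ + inner ℝ q (x - x₀) := by fun_prop
    exact (this.tendsto' x₀ 0 (by simp)).eventually_lt_const ha
  set A : ℝ := √n * (B + 1) with hAdef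
  have hA0 : 0 ≤ A := by positivity
  refine HasKLExponent.of_regular (η := f x₀ + γ)
    (K := 1 + √(2 * (K + C + ‖q‖)) * (2 * A / ε) + 2 * K₁ * (A + K * (2 * A / ε) ^ 2))
    (a := 1) ⟨?_, y₀, ?_⟩ ?_ ?_ (by positivity) (max_lt hα1 (by norm_num)) ?_ ?_ one_pos ?_
  · intro y; rw [hΦφ]; exact hproper.1 _
  · rw [hΦφ]; simp only [← hxy, hη]; exact EReal.coe_ne_top _
  · rw [hΦφ]; exact fun y => (hlsc (sqMap y)).comp continuous_sqMap.continuousAt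
  · refine ⟨0, IsRegularSubgradient.mem_subdiff ?_⟩
    rw [hΦφ]
    refine isRegularSubgradient_zero_comp_sqMap ?_
    rw [← hxy]
    have := h0.isRegularSubgradient hgb hφ (hd x₀) hγ
    rwa [hq, add_neg_cancel] at this
  · rw [hΦφ]; simp only [← hxy, hη]
  · positivity
  have hall := ((hnear.and hproj).and (hgrad.and hval)).and
    (((hTt.eventually hgrad).and (hTt.eventually hfval)).and
      (((show ∀ᶠ x in 𝓝 x₀, x ∈ t from ht).and (hTt.eventually ht)).and
        (hlin.and (hTt.eventually hkl))))
  filter_upwards [hsupp, hsqc.eventually hall] with y hy hx r hr hr0 hr1 v hv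
  obtain ⟨⟨⟨hx1, hx2⟩, hx3, hx4⟩, ⟨hx5, hx6⟩, ⟨hx7, hx8⟩, hx9, hx10⟩ := hx
  set x := sqMap y with hxdef
  have hgxt : g x ≠ ⊤ := by
    intro h; rw [hΦ, ← hxdef, h] at hr; simp at hr
  obtain ⟨γx, hγx⟩ := EReal.exists_real (hgb x) hgxt
  have hr' : r = f x + γx := by
    rw [hΦ, ← hxdef, hγx] at hr; exact_mod_cast hr.symm
  set u := L.starProjection (x - x₀) with hu
  have hxT : x - T x = u := by simp only [hT, hu]; abel
  have hTx' : T x = x - u := rfl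
  have hx9' : γx ≤ γ + inner ℝ q (x - x₀) + C * ‖u‖ := by
    have := hx9 hgxt; rw [hγx] at this; exact_mod_cast this
  have hsh := hsharp x γx hγx.le
  rw [← hu] at hsh
  have hγxγ : |γx - γ| < ρ := by
    refine lt_of_le_of_lt ?_ hx4
    have := abs_le.1 (le_refl |inner ℝ q (x - x₀)|)
    have := mul_nonneg hε.le (norm_nonneg u)
    have := mul_nonneg hC (norm_nonneg u)
    exact abs_le.2 ⟨by linarith, by linarith⟩
  set γ' := γ + inner ℝ q (T x - x₀) with hγ'
  -- On `x₀ + Lᗮ` near `x₀`, `g` is affine: translation from `x₀` bounds it above, the subgradient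
  -- `q` below.
  have hgT : g (T x) = γ' := by
    refine le_antisymm ?_ ?_
    · have := htrans x₀ (T x - x₀) γ (by simpa using hρ) (by simpa using hρ)
        ((hTn x).trans_lt hx1) (hTx x) hγ.le
      rwa [add_sub_cancel] at this
    · by_cases hTt : g (T x) = ⊤
      · rw [hTt]; exact le_top
      · obtain ⟨τ, hτ⟩ := EReal.exists_real (hgb (T x)) hTt
        rw [hτ]
        exact_mod_cast h0 (T x) τ hτ.le
  have hγ'' : γ' = γ + inner ℝ q (x - x₀) - inner ℝ q u := by
    rw [hγ', hTx', sub_right_comm, inner_sub_right, add_sub_assoc]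
  have hzero : ∀ i, y i = 0 → y₀ i = 0 := fun i hi => by
    by_contra h; exact (hy i h).1 hi
  have hx₀z : ∀ i, y₀ i = 0 → x₀ i = 0 := fun i hi => by rw [hxy, sqMap_apply, hi]; norm_num
  have hui : ∀ i, y₀ i = 0 → u i = y i ^ 2 := fun i hi => by
    rw [hu, starProjection_apply_eq (hsingle i hi), PiLp.sub_apply, hx₀z i hi, sub_zero, hxdef,
      sqMap_apply]
  -- the sharp direction
  have hstep1 : ε / 2 * √‖u‖ ≤ A * ‖v‖ := by
    refine hv.sqrt_norm_le hd hgpoly hΦ hγx (γ' := γ') (q := q) (by rw [← hTx', hgT])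
      (by linarith) hx3.le (fun i hi => by rw [hui i (hzero i hi), hi]; norm_num) hA0 ?_
    exact norm_sqrtRayVelocity_neg_le_sqrt hB hy hui hx2.le
  -- directions in which `g` is affine
  set w := (gradient f x + q) - L.starProjection (gradient f x + q) with hw
  have hwL : w ∈ Lᗮ := Submodule.sub_starProjection_mem_orthogonal _
  have hwi : ∀ i, y₀ i = 0 → w i = 0 := fun i hi => by
    rw [hw, PiLp.sub_apply, starProjection_apply_eq (hsingle i hi), sub_self]
  have hstep2 : ‖w‖ ≤ A * ‖v‖ := by
    refine hv.norm_le_of_affine hd hΦ hγx (q := q) ?_ ?_ (fun i hi => hwi i (hzero i hi)) hA0 ?_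
    · have hc : Continuous fun t : ℝ => ‖t • -w‖ := by fun_prop
      have h1 := ((hc.tendsto' 0 0 (by simp)).mono_left
        (nhdsWithin_le_nhds (s := Set.Ioi (0 : ℝ)))).eventually_lt_const hρ
      filter_upwards [h1] with t ht
      have := htrans x (t • -w) γx hx1 hγxγ ht (Lᗮ.smul_mem t (neg_mem hwL)) hγx.le
      rwa [inner_smul_right] at this
    · have h1 : inner ℝ (L.starProjection (gradient f x + q)) w = 0 :=
        (Submodule.mem_orthogonal L w).1 hwL _ (Submodule.starProjection_apply_mem L _)
      have h2 : gradient f x + q = w + L.starProjection (gradient f x + q) := by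
        rw [hw, sub_add_cancel]
      rw [← hxdef, h2, inner_add_left, h1, add_zero, real_inner_self_eq_norm_sq]
    · exact norm_sqrtRayVelocity_neg_le hB hy hwi
  -- the Kurdyka–Łojasiewicz inequality of `φ` at `T x`
  set w' := (gradient f (T x) + q) - L.starProjection (gradient f (T x) + q) with hw'
  -- Removing the `L`-part of `∇f(T x) + q` is allowed because it is shorter than `ε`. The resulting
  -- subgradient of `g` at `x₀` remains one at `T x`, since `T x - x₀ ∈ Lᗮ`.
  have hmem : w' ∈ subdiff φ (T x) := by
    rw [mem_subdiff_add_iff hf hgb hgpoly hφ hgT]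
    have hs : -L.starProjection (gradient f (T x) + q) ∈ subdiff φ x₀ := by
      refine hball _ (neg_mem (Submodule.starProjection_apply_mem L _)) ?_
      rw [norm_neg]
      exact (Submodule.norm_starProjection_apply_le _ _).trans (by linarith)
    intro z τ hz
    have h1 := (hS _).1 hs z τ hz
    have h2 : inner ℝ (L.starProjection (gradient f (T x) + q)) (T x - x₀) = 0 :=
      (Submodule.mem_orthogonal L _).1 (hTx x) _ (Submodule.starProjection_apply_mem L _)
    have h3 : w' - gradient f (T x) = q + -L.starProjection (gradient f (T x) + q) := by
      rw [hw']; abel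
    have h4 : z - x₀ = (z - T x) + (T x - x₀) := by abel
    rw [h3, hγ']
    rw [h4, inner_add_right, inner_add_left (y := -L.starProjection (gradient f (T x) + q))
      (z := T x - x₀), inner_neg_left, h2] at h1
    linarith
  have hφT : φ (T x) = ((f (T x) + γ' : ℝ) : EReal) := by rw [hφ, hgT]; norm_cast
  obtain ⟨hl1, hl2⟩ := hlip x hx7 (T x) hx8
  rw [hxT] at hl1 hl2
  refine rpow_max_half_le (p := ‖u‖) (u := ‖w‖) (u' := ‖w'‖) (r' := f (T x) + γ' - (f x₀ + γ))
    hα0 hα1 hr0 hr1.le (norm_nonneg _) (norm_nonneg _) hε hA0 (by positivity) hK₁.le hK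
    hstep1 hstep2 ?_ ?_ ?_
  -- In the coefficient `K + C + ‖q‖`, `K` comes from `f`, while `C` and `‖q‖` come from `γx - γ' ≤
  -- ⟨q, u⟩ + C ‖u‖`.
  · have h1 := (abs_le.1 (abs_real_inner_le_norm q u)).2
    have h2 := (abs_le.1 hl1).2
    rw [hr']
    linarith
  · intro hpos
    exact hx10 _ hφT hpos (by rw [hγ']; linarith) w' hmem
  · have h1 : w' - w = (gradient f (T x) - gradient f x)
        - L.starProjection (gradient f (T x) - gradient f x) := by
      have : gradient f (T x) - gradient f x = (gradient f (T x) + q) - (gradient f x + q) := by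
        abel
      rw [this, map_sub, hw, hw']; abel
    have h2 : ‖w' - w‖ ≤ K * ‖u‖ := by
      rw [h1]
      refine (norm_sub_starProjection_le _ _).trans ?_
      rwa [norm_sub_rev]
    have h3 := norm_le_insert' w' w
    linarith
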